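/- **Setting.** Let $n\ge 1$ be an integer and let $r\ge 0$, $R>0$ and $0<\epsilon\le 1$ be real numbers with $\epsilon<R$. Let $$L_{n,\epsilon}=\{(i\epsilon,j\epsilon) : i,j\in\mathbb{N},\ i,j\le \sqrt n/\epsilon\},\qquad \Gamma(\mathbf x)=\{\mathbf y\in L_{n,\epsilon} : d(\mathbf x,\mathbf y)\le r\}\quad(\mathbf x\in L_{n,\epsilon}),$$ where $d$ is the Euclidean distance. Each of $n$ nodes performs, independently of the others, the random walk on $L_{n,\epsilon}$ which from position $\mathbf x$ moves to a uniformly random element of $\Gamma(\mathbf x)$. The joint positions $P_t=(P_{1,t},\dots,P_{n,t})$ form a Markov chain on $L_{n,\epsilon}^n$. Its stationary distribution is unique if $r\ge\epsilon$; if $r<\epsilon$ the nodes never move, and the stationary distribution is understood to be the product of the one-node distributions $\pi(\mathbf x)=|\Gamma(\mathbf x)|/\sum_{\mathbf y}|\Gamma(\mathbf y)|$. The geometric Markovian evolving graph $\mathcal G(n,r,R,\epsilon)$ has at time $t$ the graph $G_t$ on $[n]=\{1,\dots,n\}$ in which two distinct nodes $i,j$ are adjacent if and only if $d(P_{i,t},P_{j,t})\le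 R$. Its stationary distribution is the distribution of this graph when $P_t$ has the stationary distribution. For real numbers $h,k$, a graph $G$ on $[n]$ is an $(h,k)$-expander if every $I\subseteq[n]$ with $|I|\le h$ satisfies $|N(I)|\ge k|I|$, where $N(I)$ is the set of nodes outside $I$ with at least one neighbor in $I$. **Theorem.** There are absolute constants $c,\alpha,\beta>0$ such that, for all $n,r,R,\epsilon$ as above with $c\sqrt{\log n}\le R\le\sqrt n$ (natural logarithm), a random graph $G$ with the stationary distribution of $\mathcal G(n,r,R,\epsilon)$ has, with probability at least $1-\frac1{n^2}$, both of the following properties: * $G$ is an $\left(h,\alpha\frac{R^2}{h}\right)$-expander for every real $h$ with $1\le h\le\alpha R^2$; * $G$ is an $\left(h,\beta\frac{R}{\sqrt h}\right)$-expander for every real $h$ with $\alpha R^2\le h\le n/2$. -/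

import Mathlib

noncomputable section

namespace GeometricMEG

/-- The index set of the grid `L_{n,ε}`: pairs `(i, j)` of natural numbers with
`i, j ≤ √n / ε`. -/
abbrev GridPos (n : ℕ) (ε : ℝ) : Type :=
  Fin (⌊√(n : ℝ) / ε⌋₊ + 1) × Fin (⌊√(n : ℝ) / ε⌋₊ + 1)

/-- The point `(iε, jε)` of the Euclidean plane with grid indices `(i, j)`. -/
def point {n : ℕ} {ε : ℝ} (x : GridPos n ε) : EuclideanSpace ℝ (Fin 2) :=
  !₂[(x.1 : ℕ) * ε, (x.2 : ℕ) * ε]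

open Classical in
/-- `Γ(x)`: the grid positions within Euclidean distance `r` of `x` (`x` included). -/
def moveSet {n : ℕ} {ε : ℝ} (r : ℝ) (x : GridPos n ε) : Finset (GridPos n ε) :=
  Finset.univ.filter fun y => dist (point x) (point y) ≤ r

open Classical in
/-- Transition probabilities of one node: a uniformly random position of `Γ(x)`. -/
def nodeTransition {n : ℕ} {ε : ℝ} (r : ℝ) (x y : GridPos n ε) : ℝ :=
  if y ∈ moveSet r x then 1 / ((moveSet r x).card : ℝ) else 0

/-- The joint positions of the `n` nodes. -/
abbrev Config (n : ℕ) (ε : ℝ) : Type := Fin n → GridPos n ε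

/-- Transition probabilities of the chain of all the nodes, which move independently. -/
def transition {n : ℕ} {ε : ℝ} (r : ℝ) (X Y : Config n ε) : ℝ :=
  ∏ i, nodeTransition r (X i) (Y i)

/-- `π` is a stationary distribution of the finite Markov chain with transition
probabilities `T`. -/
structure IsStationaryDistribution {S : Type*} [Fintype S] (T : S → S → ℝ) (π : S → ℝ) :
    Prop where
  nonneg : ∀ x, 0 ≤ π x
  sum_eq_one : ∑ x, π x = 1
  invariant : ∀ y, ∑ x, π x * T x y = π y

/-- The distribution `|Γ(x)| / ∑ y, |Γ(y)|` of the position of one node. -/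
def nodeStationary {n : ℕ} {ε : ℝ} (r : ℝ) (x : GridPos n ε) : ℝ :=
  ((moveSet r x).card : ℝ) / ∑ y : GridPos n ε, ((moveSet r y).card : ℝ)

/-- `π` is the law of the positions of the nodes in the stationary geometric-MEG: a stationary
distribution of the chain of all the nodes. If `ε ≤ r` this chain is irreducible, so there
is only one. If `r < ε` the nodes never move and every distribution is stationary; the one
that is meant is then still the product of the distributions `nodeStationary`. -/
structure IsStationaryLaw {n : ℕ} {ε : ℝ} (r : ℝ) (π : Config n ε → ℝ) : Prop where
  stationary : IsStationaryDistribution (transition r) π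
  eq_prod_of_lt : r < ε → ∀ X, π X = ∏ i, nodeStationary r (X i)

/-- The graph on the nodes with an edge between any two distinct nodes at distance at most
`R`. -/
def graph {n : ℕ} {ε : ℝ} (R : ℝ) (X : Config n ε) : SimpleGraph (Fin n) where
  Adj i j := i ≠ j ∧ dist (point (X i)) (point (X j)) ≤ R
  symm := ⟨fun _ _ h => ⟨h.1.symm, by rw [dist_comm]; exact h.2⟩⟩
  loopless := ⟨fun _ h => h.1 rfl⟩

open Classical in
/-- `N(I)`: the nodes outside `I` that have a neighbor in `I`. -/
def outNeighborhood {V : Type*} [Fintype V] (G : SimpleGraph V) (I : Finset V) : Finset V :=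
  Finset.univ.filter fun v => v ∉ I ∧ ∃ u ∈ I, G.Adj u v

/-- `G` is an `(h, k)`-expander. -/
def IsExpander {V : Type*} [Fintype V] (G : SimpleGraph V) (h k : ℝ) : Prop :=
  ∀ I : Finset V, (I.card : ℝ) ≤ h → k * (I.card : ℝ) ≤ ((outNeighborhood G I).card : ℝ)

open Classical in
/-- The probability of the event `E` under the distribution `π` on a finite set. -/
def prob {S : Type*} [Fintype S] (π : S → ℝ) (E : S → Prop) : ℝ :=
  ∑ x ∈ Finset.univ.filter E, π x

end GeometricMEG

end

/-!
The stationary law is explicit, and the graph is a geometric graph on independent, nearly uniform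
points; its expansion comes from the isoperimetric inequality of a grid of cells.

*The law.* If `ε ≤ r`, the joint chain is irreducible and reversible with respect to the positive
product weights `∏ i, nodeStationary r (X i)`, so the maximum principle shows that there is no other
stationary law (`IsStationaryLaw.eq_prod`); for `r < ε` this is the definition. Halving
displacements gives a map from `Γ(y)` to `Γ(x)` that is at most `16` to one, so the law of one node
is within a factor `16` of the uniform law (`card_moveSet_le`).

*The cells.* The grid positions are divided into an `m × m` grid of cells of side of order `R`, such
that nodes in equal or neighboring cells are adjacent (`dist_le_of_gridCell`). The expected number
of nodes in a cell is of order `R ^ 2` (`cell_mass_bounds`). As `R ^ 2` is at least a large multiple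
of `log n`, a Chernoff bound and a union bound over the at most `n` cells show that, with
probability at least `1 - 1 / n ^ 2`, every cell holds between `lo` and `hi` nodes, both of order `R
^ 2` (`sum_prob_bad_cells_le`).

*The expansion.* Given such occupation numbers, the rest is deterministic. The nodes of a cell that
meets `I` all lie in `I` or neighbor `I`, which gives `lo - |I|` neighbors and settles small `I`.
For larger `I`, call a cell black if at least half of its nodes lie in `I`
(`outNeighborhood_large_of_cells`). If at most half of the cells met by `I` are black, the others
contribute a number of neighbors proportional to `|I|`. If nearly all the cells of the grid are
black, they contain at least a quarter of all nodes as neighbors of `I`, because `|I| ≤ n / 2`.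
Otherwise the black cells have an outer boundary of at least a constant times the square root of
their number (`mul_sqrt_card_le_card_outerBoundary`), and at least half of each boundary cell
neighbors `I`.
-/

namespace GeometricMEG

/-! ### Uniqueness of the stationary law -/

/-- By reversibility the density `π / ν` of a stationary distribution is harmonic, so by the
maximum principle it is constant on an irreducible chain. -/
theorem IsStationaryDistribution.eq_of_reversible {S : Type*} [Fintype S] {T : S → S → ℝ}
    {ν π : S → ℝ} (hT0 : ∀ x y, 0 ≤ T x y) (hT1 : ∀ x, ∑ y, T x y = 1) (hν : ∀ x, 0 < ν x)
    (hν1 : ∑ x, ν x = 1) (hrev : ∀ x y, ν x * T x y = ν y * T y x)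
    (hirr : ∀ P : S → Prop, (∀ x y, 0 < T x y → P x → P y) → ∀ x y, P x → P y)
    (hπ : IsStationaryDistribution T π) : π = ν := by
  have hne : Nonempty S := by
    by_contra h
    rw [not_nonempty_iff] at h
    simp at hν1
  obtain ⟨x₀, hx₀⟩ := Finite.exists_max fun x => π x / ν x
  have harm : ∀ x, ∑ y, T x y * (π y / ν y) = π x / ν x := by
    intro x
    rw [eq_div_iff (hν x).ne', Finset.sum_mul, ← hπ.invariant x]
    refine Finset.sum_congr rfl fun y _ => ?_
    have h := hrev x y
    have := (hν y).ne'
    field_simp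
    linear_combination (π y) * h
  have hconst : ∀ y, π y / ν y = π x₀ / ν x₀ := by
    intro y
    refine hirr (fun x => π x / ν x = π x₀ / ν x₀) ?_ x₀ y rfl
    intro x y hxy hx
    by_contra hne
    have hlt : π y / ν y < π x₀ / ν x₀ := lt_of_le_of_ne (hx₀ y) hne
    have : ∑ z, T x z * (π z / ν z) < ∑ z, T x z * (π x₀ / ν x₀) :=
      Finset.sum_lt_sum (fun z _ => mul_le_mul_of_nonneg_left (hx₀ z) (hT0 x z))
        ⟨y, Finset.mem_univ y, mul_lt_mul_of_pos_left hlt hxy⟩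
    rw [harm, ← Finset.sum_mul, hT1, one_mul] at this
    exact this.ne hx
  have hmul : ∀ y, π y = π x₀ / ν x₀ * ν y := fun y => by
    rw [← hconst y, div_mul_cancel₀ _ (hν y).ne']
  have hone : π x₀ / ν x₀ = 1 := by
    have := hπ.sum_eq_one
    rw [Finset.sum_congr rfl fun y _ => hmul y, ← Finset.mul_sum, hν1, mul_one] at this
    exact this
  funext y
  rw [hmul y, hone, one_mul]

section
variable {n : ℕ} {ε r : ℝ}

theorem dist_point (hε : 0 ≤ ε) (x y : GridPos n ε) :
    dist (point x) (point y) =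
      √((((x.1 : ℕ) : ℝ) - (y.1 : ℕ)) ^ 2 + (((x.2 : ℕ) : ℝ) - (y.2 : ℕ)) ^ 2) * ε := by
  rw [EuclideanSpace.dist_eq]
  have : ∀ a b : ℝ, dist (a * ε) (b * ε) ^ 2 = (a - b) ^ 2 * ε ^ 2 := fun a b => by
    rw [Real.dist_eq, sq_abs]; ring
  simp only [point, Fin.sum_univ_two, PiLp.toLp_apply, Matrix.cons_val_zero, Matrix.cons_val_one,
    this]
  rw [← add_mul, Real.sqrt_mul (by positivity), Real.sqrt_sq hε]

theorem mem_moveSet (x y : GridPos n ε) :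
    y ∈ moveSet r x ↔ dist (point x) (point y) ≤ r := by
  simp [moveSet]

theorem self_mem_moveSet (hr : 0 ≤ r) (x : GridPos n ε) : x ∈ moveSet r x := by
  simpa [mem_moveSet] using hr

theorem card_moveSet_pos (hr : 0 ≤ r) (x : GridPos n ε) : 0 < ((moveSet r x).card : ℝ) := by
  exact_mod_cast Finset.card_pos.2 ⟨x, self_mem_moveSet hr x⟩

theorem sum_card_moveSet_pos (hr : 0 ≤ r) :
    0 < ∑ y : GridPos n ε, ((moveSet r y).card : ℝ) :=
  Finset.sum_pos (fun y _ => card_moveSet_pos hr y) ⟨(0, 0), Finset.mem_univ _⟩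

theorem nodeStationary_pos (hr : 0 ≤ r) (x : GridPos n ε) : 0 < nodeStationary r x :=
  div_pos (card_moveSet_pos hr x) (sum_card_moveSet_pos hr)

theorem sum_nodeStationary (hr : 0 ≤ r) : ∑ x : GridPos n ε, nodeStationary r x = 1 := by
  unfold nodeStationary
  rw [← Finset.sum_div, div_self (sum_card_moveSet_pos hr).ne']

theorem nodeTransition_nonneg (x y : GridPos n ε) : 0 ≤ nodeTransition r x y := by
  unfold nodeTransition
  split_ifs <;> positivity

theorem sum_nodeTransition (hr : 0 ≤ r) (x : GridPos n ε) : ∑ y, nodeTransition r x y = 1 := by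
  classical
  have := (card_moveSet_pos hr x).ne'
  simp only [nodeTransition, Finset.sum_ite_mem, Finset.univ_inter, Finset.sum_const, nsmul_eq_mul]
  field_simp

theorem nodeStationary_mul_nodeTransition_comm (hr : 0 ≤ r) (x y : GridPos n ε) :
    nodeStationary r x * nodeTransition r x y = nodeStationary r y * nodeTransition r y x := by
  have hx := (card_moveSet_pos hr x).ne'
  have hy := (card_moveSet_pos hr y).ne'
  have hiff : y ∈ moveSet r x ↔ x ∈ moveSet r y := by
    rw [mem_moveSet, mem_moveSet, dist_comm]
  unfold nodeStationary nodeTransition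
  by_cases h : y ∈ moveSet r x
  · rw [if_pos h, if_pos (hiff.1 h)]
    field_simp
  · rw [if_neg h, if_neg (mt hiff.2 h)]
    simp

/-- The number at distance at most `t` from `x` that is closest to `y`. -/
def stepToward (x y t : ℕ) : ℕ := max (x - t) (min (x + t) y)

theorem stepToward_le {x y t N : ℕ} (hx : x < N) (hy : y < N) : stepToward x y t < N := by
  unfold stepToward; omega

theorem stepToward_zero (x y : ℕ) : stepToward x y 0 = x := by
  unfold stepToward; omega

theorem stepToward_of_lt {x y N : ℕ} (hx : x < N) (hy : y < N) : stepToward x y N = y := by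
  unfold stepToward; omega

theorem sq_stepToward_sub_le (x y t : ℕ) :
    ((stepToward x y t : ℝ) - (stepToward x y (t + 1) : ℕ)) ^ 2 ≤ 1 := by
  rw [sq_le_one_iff_abs_le_one, abs_le]
  have h1 : stepToward x y t ≤ stepToward x y (t + 1) + 1 := by unfold stepToward; omega
  have h2 : stepToward x y (t + 1) ≤ stepToward x y t + 1 := by unfold stepToward; omega
  have h1' : (stepToward x y t : ℝ) ≤ (stepToward x y (t + 1) : ℕ) + 1 := by exact_mod_cast h1
  have h2' : (stepToward x y (t + 1) : ℝ) ≤ (stepToward x y t : ℕ) + 1 := by exact_mod_cast h2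
  constructor <;> linarith

/-- All the nodes can be moved at once, one grid step at a time: first horizontally, then
vertically. -/
theorem transition_irreducible (hε : 0 < ε) (hεr : ε ≤ r) (P : Config n ε → Prop)
    (hP : ∀ X Y : Config n ε, 0 < transition r X Y → P X → P Y) (X Y : Config n ε)
    (hX : P X) : P Y := by
  have hr : 0 ≤ r := hε.le.trans hεr
  have step : ∀ X Y : Config n ε, (∀ i, dist (point (X i)) (point (Y i)) ≤ r) → P X → P Y := by
    intro X Y h
    refine hP X Y (Finset.prod_pos fun i _ => ?_)
    rw [nodeTransition, if_pos ((mem_moveSet _ _).2 (h i))]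
    exact one_div_pos.2 (card_moveSet_pos hr _)
  have hle : ∀ s : ℝ, s ≤ 1 → √s * ε ≤ r := fun s hs =>
    (mul_le_of_le_one_left hε.le (Real.sqrt_le_one.2 hs)).trans hεr
  have horizontal : ∀ t : ℕ, P fun i =>
      (⟨stepToward (X i).1 (Y i).1 t, stepToward_le (X i).1.2 (Y i).1.2⟩, (X i).2) := by
    intro t
    induction t with
    | zero => simpa only [stepToward_zero] using hX
    | succ t ih =>
      refine step _ _ (fun i => ?_) ih
      rw [dist_point hε.le]
      refine hle _ ?_
      simpa using sq_stepToward_sub_le _ _ t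
  have vertical : ∀ t : ℕ, P fun i =>
      ((Y i).1, ⟨stepToward (X i).2 (Y i).2 t, stepToward_le (X i).2.2 (Y i).2.2⟩) := by
    intro t
    induction t with
    | zero =>
      have := horizontal (⌊√(n : ℝ) / ε⌋₊ + 1)
      simpa only [stepToward_zero, stepToward_of_lt (X _).1.2 (Y _).1.2] using this
    | succ t ih =>
      refine step _ _ (fun i => ?_) ih
      rw [dist_point hε.le]
      refine hle _ ?_
      simpa using sq_stepToward_sub_le _ _ t
  simpa only [stepToward_of_lt (X _).2.2 (Y _).2.2] using vertical (⌊√(n : ℝ) / ε⌋₊ + 1)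

theorem IsStationaryLaw.eq_prod (hε : 0 < ε) (hr : 0 ≤ r) {π : Config n ε → ℝ}
    (hπ : IsStationaryLaw r π) : π = fun X => ∏ i, nodeStationary r (X i) := by
  rcases lt_or_ge r ε with h | h
  · exact funext (hπ.eq_prod_of_lt h)
  · refine hπ.stationary.eq_of_reversible ?_ ?_ ?_ ?_ ?_ (transition_irreducible hε h)
    · exact fun X Y => Finset.prod_nonneg fun i _ => nodeTransition_nonneg _ _
    · intro X
      unfold transition
      rw [← Fintype.prod_sum fun i => nodeTransition r (X i)]
      simp [sum_nodeTransition hr]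
    · exact fun X => Finset.prod_pos fun i _ => nodeStationary_pos hr _
    · rw [← Fintype.prod_sum fun _ : Fin n => nodeStationary (n := n) (ε := ε) r]
      simp [sum_nodeStationary hr]
    · intro X Y
      unfold transition
      rw [← Finset.prod_mul_distrib, ← Finset.prod_mul_distrib]
      exact Finset.prod_congr rfl fun i _ => nodeStationary_mul_nodeTransition_comm hr _ _

end

/-! ### The law of one node is nearly uniform -/

/-- The point at distance `|z - y| / 2` (rounded down) from `x`, on the side of `x` on which
`{0, …, N}` has more room. -/
def halfShift (N x y z : ℕ) : ℕ :=
  if 2 * x ≤ N then x + ((z - y) + (y - z)) / 2 else x - ((z - y) + (y - z)) / 2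

theorem halfShift_lt {N x y z : ℕ} (hx : x < N + 1) (hy : y < N + 1) (hz : z < N + 1) :
    halfShift N x y z < N + 1 := by
  unfold halfShift; split_ifs <;> omega

theorem sq_sub_halfShift_le (N x y z : ℕ) :
    ((x : ℝ) - (halfShift N x y z : ℕ)) ^ 2 ≤ ((y : ℝ) - z) ^ 2 := by
  rw [sq_le_sq]
  have h : |(x : ℤ) - (halfShift N x y z : ℕ)| ≤ |(y : ℤ) - z| := by
    rw [Int.abs_eq_natAbs, Int.abs_eq_natAbs]
    unfold halfShift
    split_ifs <;> omega
  exact_mod_cast h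

theorem halfShift_injective {N x y z z' : ℕ} (hy : y < N + 1) (hz : z < N + 1) (hz' : z' < N + 1)
    (h : halfShift N x y z = halfShift N x y z') (hle : y ≤ z ↔ y ≤ z')
    (hpar : z % 2 = 0 ↔ z' % 2 = 0) : z = z' := by
  unfold halfShift at h
  split_ifs at h <;> omega

section
variable {n : ℕ} {ε r : ℝ}

/-- Halving the displacement and reflecting it into the grid maps `Γ(y)` to `Γ(x)`; in each
coordinate, the direction of the displacement and one parity determine the preimage. -/
theorem card_moveSet_le (hε : 0 < ε) (x y : GridPos n ε) :
    ((moveSet r y).card : ℝ) ≤ 16 * (moveSet r x).card := by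
  have key : (moveSet r y).card ≤
      (moveSet r x ×ˢ (Finset.univ : Finset ((Bool × Bool) × (Bool × Bool)))).card := by
    refine Finset.card_le_card_of_injOn (fun z =>
      ((⟨halfShift _ x.1 y.1 z.1, halfShift_lt x.1.2 y.1.2 z.1.2⟩,
        ⟨halfShift _ x.2 y.2 z.2, halfShift_lt x.2.2 y.2.2 z.2.2⟩),
        (decide ((y.1 : ℕ) ≤ z.1), decide ((z.1 : ℕ) % 2 = 0)),
        (decide ((y.2 : ℕ) ≤ z.2), decide ((z.2 : ℕ) % 2 = 0)))) ?_ ?_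
    · intro z hz
      have hz' := (mem_moveSet _ _).1 hz
      rw [dist_point hε.le] at hz'
      refine Finset.mem_product.2 ⟨(mem_moveSet _ _).2 (le_trans ?_ hz'), Finset.mem_univ _⟩
      rw [dist_point hε.le]
      exact mul_le_mul_of_nonneg_right (Real.sqrt_le_sqrt (add_le_add
        (sq_sub_halfShift_le _ _ _ _) (sq_sub_halfShift_le _ _ _ _))) hε.le
    · intro z _ z' _ h
      simp only [Prod.mk.injEq, Fin.mk.injEq, decide_eq_decide] at h
      obtain ⟨⟨h1, h2⟩, ⟨h3, h4⟩, h5, h6⟩ := h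
      exact Prod.ext (Fin.ext (halfShift_injective y.1.2 z.1.2 z'.1.2 h1 h3 h4))
        (Fin.ext (halfShift_injective y.2.2 z.2.2 z'.2.2 h2 h5 h6))
  rw [Finset.card_product] at key
  simp only [Finset.card_univ, Fintype.card_prod, Fintype.card_bool] at key
  have : (moveSet r y).card ≤ 16 * (moveSet r x).card := by omega
  exact_mod_cast this

theorem le_nodeStationary (hε : 0 < ε) (hr : 0 ≤ r) (x : GridPos n ε) :
    1 / (16 * (Fintype.card (GridPos n ε) : ℝ)) ≤ nodeStationary r x := by
  have hc : (0 : ℝ) < Fintype.card (GridPos n ε) := by exact_mod_cast Fintype.card_pos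
  have h : ∑ y : GridPos n ε, ((moveSet r y).card : ℝ)
      ≤ Fintype.card (GridPos n ε) * (16 * (moveSet r x).card) := by
    have := Finset.sum_le_card_nsmul Finset.univ (fun y : GridPos n ε => ((moveSet r y).card : ℝ)) _
      fun y _ => card_moveSet_le hε x y
    simpa only [Finset.card_univ, nsmul_eq_mul] using this
  rw [nodeStationary, div_le_div_iff₀ (by positivity) (sum_card_moveSet_pos hr)]
  linarith

theorem nodeStationary_le (hε : 0 < ε) (hr : 0 ≤ r) (x : GridPos n ε) :
    nodeStationary r x ≤ 16 / (Fintype.card (GridPos n ε) : ℝ) := by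
  have hc : (0 : ℝ) < Fintype.card (GridPos n ε) := by exact_mod_cast Fintype.card_pos
  have h : Fintype.card (GridPos n ε) * (((moveSet r x).card : ℝ) / 16)
      ≤ ∑ y : GridPos n ε, ((moveSet r y).card : ℝ) := by
    have := Finset.card_nsmul_le_sum Finset.univ (fun y : GridPos n ε => ((moveSet r y).card : ℝ))
      (((moveSet r x).card : ℝ) / 16) fun y _ => by linarith [card_moveSet_le (r := r) hε y x]
    simpa only [Finset.card_univ, nsmul_eq_mul] using this
  rw [nodeStationary, div_le_div_iff₀ (sum_card_moveSet_pos hr) hc]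
  linarith

end

/-! ### Concentration of occupation numbers -/

section
variable {S : Type*} [Fintype S]

theorem prob_nonneg {π : S → ℝ} (hπ : ∀ x, 0 ≤ π x) (E : S → Prop) : 0 ≤ prob π E :=
  Finset.sum_nonneg fun x _ => hπ x

/-- Chernoff bound, for the upper tail when `0 < s` and for the lower tail when `s < 0`, of the
number of independent nodes in one cell. -/
theorem prob_card_le_exp {κ : Type*} [DecidableEq κ] (cell : S → κ) (C : κ) {ν : S → ℝ}
    (hν : ∀ x, 0 ≤ ν x) (hν1 : ∑ x, ν x = 1) (n : ℕ) (s t : ℝ) :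
    prob (fun X : Fin n → S => ∏ i, ν (X i))
        (fun X => t ≤ s * ((Finset.univ.filter fun i => cell (X i) = C).card : ℝ))
      ≤ Real.exp (n * (∑ x with cell x = C, ν x) * (Real.exp s - 1) - t) := by
  classical
  set f : S → ℝ := fun x => ν x * (if cell x = C then Real.exp s else 1) with hf
  have hf0 : ∀ x, 0 ≤ f x := fun x => mul_nonneg (hν x) (by split_ifs <;> positivity)
  have hprod : ∀ X : Fin n → S, ∏ i, f (X i) = (∏ i, ν (X i)) *
      Real.exp (s * ((Finset.univ.filter fun i => cell (X i) = C).card : ℝ)) := by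
    intro X
    rw [hf, Finset.prod_mul_distrib, Finset.prod_ite, Finset.prod_const, Finset.prod_const_one,
      mul_one, mul_comm s, Real.exp_nat_mul]
  have hsum : ∑ x, f x = 1 + (∑ x with cell x = C, ν x) * (Real.exp s - 1) := by
    have h1 : ∀ x, f x = ν x + (if cell x = C then ν x * (Real.exp s - 1) else 0) := by
      intro x
      simp only [hf]
      split_ifs <;> ring
    rw [Finset.sum_congr rfl fun x _ => h1 x, Finset.sum_add_distrib, hν1, ← Finset.sum_filter,
      Finset.sum_mul]
  calc prob (fun X : Fin n → S => ∏ i, ν (X i))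
        (fun X => t ≤ s * ((Finset.univ.filter fun i => cell (X i) = C).card : ℝ))
      ≤ ∑ X ∈ Finset.univ.filter (fun X : Fin n → S =>
          t ≤ s * ((Finset.univ.filter fun i => cell (X i) = C).card : ℝ)),
          Real.exp (-t) * ∏ i, f (X i) := by
        refine Finset.sum_le_sum fun X hX => ?_
        have ht := (Finset.mem_filter.1 hX).2
        rw [hprod, mul_left_comm, ← Real.exp_add]
        refine le_mul_of_one_le_right (Finset.prod_nonneg fun i _ => hν _) (Real.one_le_exp ?_)
        linarith
    _ ≤ ∑ X : Fin n → S, Real.exp (-t) * ∏ i, f (X i) :=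
        Finset.sum_le_sum_of_subset_of_nonneg (Finset.subset_univ _) fun X _ _ =>
          mul_nonneg (Real.exp_pos _).le (Finset.prod_nonneg fun i _ => hf0 _)
    _ = Real.exp (-t) * (∑ x, f x) ^ n := by
        rw [← Finset.mul_sum, ← Fintype.prod_sum fun _ : Fin n => f]
        simp
    _ ≤ Real.exp (-t) * Real.exp ((∑ x with cell x = C, ν x) * (Real.exp s - 1)) ^ n := by
        refine mul_le_mul_of_nonneg_left ?_ (Real.exp_pos _).le
        refine pow_le_pow_left₀ (Finset.sum_nonneg fun x _ => hf0 x) ?_ n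
        rw [hsum, add_comm]
        exact Real.add_one_le_exp _
    _ = _ := by
        rw [← Real.exp_nat_mul, ← Real.exp_add]
        congr 1
        ring

open Classical in
theorem one_sub_sum_le_prob {π : S → ℝ} (hπ : ∀ x, 0 ≤ π x) (hπ1 : ∑ x, π x = 1) {E : S → Prop}
    {κ : Type*} [Fintype κ] {F : κ → S → Prop} (h : ∀ x, ¬ E x → ∃ k, F k x) :
    1 - ∑ k, prob π (F k) ≤ prob π E := by
  have h1 : prob π E + prob π (fun x => ¬ E x) = 1 := by
    unfold prob
    rw [← hπ1, Finset.sum_filter, Finset.sum_filter, ← Finset.sum_add_distrib]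
    refine Finset.sum_congr rfl fun x _ => ?_
    by_cases hx : E x <;> simp [hx]
  have h2 : prob π (fun x => ¬ E x) ≤ ∑ k, prob π (F k) := by
    unfold prob
    simp only [Finset.sum_filter]
    rw [Finset.sum_comm]
    refine Finset.sum_le_sum fun x _ => ?_
    have hnn : ∀ k ∈ Finset.univ, 0 ≤ if F k x then π x else 0 := fun k _ => by
      split_ifs
      exacts [hπ x, le_rfl]
    split_ifs with hx
    · exact Finset.sum_nonneg hnn
    · obtain ⟨k, hk⟩ := h x hx
      have := Finset.single_le_sum hnn (Finset.mem_univ k)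
      rwa [if_pos hk] at this
  linarith

end

/-! ### Vertex isoperimetry in a square grid -/

/-- Two cells of the `m × m` grid share a side. -/
def IsNextTo {m : ℕ} (C D : Fin m × Fin m) : Prop :=
  (C.1 = D.1 ∧ ((C.2 : ℕ) + 1 = D.2 ∨ (D.2 : ℕ) + 1 = C.2)) ∨
    (C.2 = D.2 ∧ ((C.1 : ℕ) + 1 = D.1 ∨ (D.1 : ℕ) + 1 = C.1))

open Classical in
/-- The cells outside `B` that share a side with a cell of `B`. -/
noncomputable def outerBoundary {m : ℕ} (B : Finset (Fin m × Fin m)) : Finset (Fin m × Fin m) :=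
  Finset.univ.filter fun C => C ∉ B ∧ ∃ D ∈ B, IsNextTo D C

theorem exists_consecutive {m : ℕ} (p : Fin m → Prop) {i j : Fin m} (hi : p i) (hj : ¬ p j) :
    ∃ a b : Fin m, p a ∧ ¬ p b ∧ ((a : ℕ) + 1 = b ∨ (b : ℕ) + 1 = a) := by
  by_contra! H
  have up : ∀ d (h : (i : ℕ) + d < m), p ⟨i + d, h⟩ := by
    intro d
    induction d with
    | zero => exact fun _ => hi
    | succ d ih =>
      intro h
      by_contra hn
      exact (H ⟨i + d, by omega⟩ ⟨i + (d + 1), h⟩ (ih (by omega)) hn).1 (by simp; omega)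
  have down : ∀ d (h : (i : ℕ) - d < m), p ⟨i - d, h⟩ := by
    intro d
    induction d with
    | zero => exact fun _ => hi
    | succ d ih =>
      intro h
      by_contra hn
      by_cases h0 : (i : ℕ) ≤ d
      · have := ih (by omega)
        have e : (i : ℕ) - d = i - (d + 1) := by omega
        simp only [e] at this
        exact hn this
      · exact (H ⟨i - d, by omega⟩ ⟨i - (d + 1), h⟩ (ih (by omega)) hn).2 (by simp; omega)
  rcases le_total (i : ℕ) j with h | h
  · have e : (i : ℕ) + (j - i) = j := by omega
    have := up (j - i) (by omega)
    simp only [e] at this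
    exact hj this
  · have e : (i : ℕ) - (i - j) = j := by omega
    have := down (i - j) (by omega)
    simp only [e] at this
    exact hj this

section
variable {m : ℕ} (B : Finset (Fin m × Fin m))

open Classical in
/-- A line of the grid that `B` meets but does not contain has a cell in the outer boundary. -/
theorem card_mixed_rows_le :
    (Finset.univ.filter fun i : Fin m => (∃ j, (i, j) ∈ B) ∧ ∃ j, (i, j) ∉ B).card
      ≤ (outerBoundary B).card := by
  refine le_trans (Finset.card_le_card ?_) (Finset.card_image_le (f := Prod.fst))
  intro i hi
  obtain ⟨⟨j, hj⟩, j', hj'⟩ := (Finset.mem_filter.1 hi).2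
  obtain ⟨a, b, ha, hb, hab⟩ := exists_consecutive (fun j => (i, j) ∈ B) hj hj'
  exact Finset.mem_image.2 ⟨(i, b), Finset.mem_filter.2
    ⟨Finset.mem_univ _, hb, (i, a), ha, Or.inl ⟨rfl, hab⟩⟩, rfl⟩

open Classical in
theorem card_mixed_columns_le :
    (Finset.univ.filter fun j : Fin m => (∃ i, (i, j) ∈ B) ∧ ∃ i, (i, j) ∉ B).card
      ≤ (outerBoundary B).card := by
  refine le_trans (Finset.card_le_card ?_) (Finset.card_image_le (f := Prod.snd))
  intro j hj
  obtain ⟨⟨i, hi⟩, i', hi'⟩ := (Finset.mem_filter.1 hj).2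
  obtain ⟨a, b, ha, hb, hab⟩ := exists_consecutive (fun i => (i, j) ∈ B) hi hi'
  exact Finset.mem_image.2 ⟨(b, j), Finset.mem_filter.2
    ⟨Finset.mem_univ _, hb, (a, j), ha, Or.inr ⟨rfl, hab⟩⟩, rfl⟩

open Classical in
/-- If `B` contains a row, then it meets every column, and the columns that it does not contain
cover the complement of `B`. -/
theorem card_compl_le_of_row {i : Fin m} (hi : ∀ j, (i, j) ∈ B) :
    Bᶜ.card ≤ m * (outerBoundary B).card := by
  have h := card_mixed_columns_le B
  refine le_trans ?_ (Nat.mul_le_mul_left m h)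
  refine le_trans (Finset.card_le_card (t := Finset.univ ×ˢ (Finset.univ.filter
    fun j : Fin m => (∃ i, (i, j) ∈ B) ∧ ∃ i, (i, j) ∉ B)) ?_) (by simp)
  rintro ⟨a, b⟩ hab
  simp only [Finset.mem_compl] at hab
  simp only [Finset.mem_product, Finset.mem_univ, Finset.mem_filter, true_and]
  exact ⟨⟨i, hi b⟩, a, hab⟩

open Classical in
theorem card_compl_le_of_column {j : Fin m} (hj : ∀ i, (i, j) ∈ B) :
    Bᶜ.card ≤ m * (outerBoundary B).card := by
  have h := card_mixed_rows_le B
  refine le_trans ?_ (Nat.mul_le_mul_left m h)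
  refine le_trans (Finset.card_le_card (t := (Finset.univ.filter
    fun i : Fin m => (∃ j, (i, j) ∈ B) ∧ ∃ j, (i, j) ∉ B) ×ˢ Finset.univ) ?_) (by simp [mul_comm])
  rintro ⟨a, b⟩ hab
  simp only [Finset.mem_compl] at hab
  simp only [Finset.mem_product, Finset.mem_univ, Finset.mem_filter, true_and]
  exact ⟨⟨⟨j, hj a⟩, b, hab⟩, trivial⟩

open Classical in
/-- `B` lies in the product of the rows and of the columns that it meets. -/
theorem card_le_sq_card_outerBoundary (hrow : ∀ i, ∃ j, (i, j) ∉ B)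
    (hcol : ∀ j, ∃ i, (i, j) ∉ B) : B.card ≤ (outerBoundary B).card ^ 2 := by
  have h1 := card_mixed_rows_le B
  have h2 := card_mixed_columns_le B
  rw [sq]
  refine le_trans ?_ (Nat.mul_le_mul h1 h2)
  rw [← Finset.card_product]
  refine Finset.card_le_card ?_
  rintro ⟨a, b⟩ hab
  simp only [Finset.mem_product, Finset.mem_univ, Finset.mem_filter, true_and]
  exact ⟨⟨⟨b, hab⟩, hrow a⟩, ⟨a, hab⟩, hcol b⟩

/-- Vertex isoperimetric inequality for sets that miss a fraction `κ` of the grid. -/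
theorem mul_sqrt_card_le_card_outerBoundary {κ : ℝ} (hκ0 : 0 ≤ κ) (hκ1 : κ ≤ 1)
    (hB : κ * (m : ℝ) ^ 2 ≤ (m : ℝ) ^ 2 - B.card) :
    κ * √(B.card : ℝ) ≤ (outerBoundary B).card := by
  classical
  rcases Nat.eq_zero_or_pos m with rfl | hm
  · have : B = ∅ := Finset.eq_empty_of_forall_notMem fun x _ => x.1.elim0
    simp [this]
  have hm' : (0 : ℝ) < m := by exact_mod_cast hm
  have hcompl : (Bᶜ.card : ℝ) = (m : ℝ) ^ 2 - B.card := by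
    rw [Finset.card_compl, Nat.cast_sub (Finset.card_le_univ B)]
    simp [sq]
  have key : Bᶜ.card ≤ m * (outerBoundary B).card →
      κ * √(B.card : ℝ) ≤ (outerBoundary B).card := by
    intro h
    have h' : (Bᶜ.card : ℝ) ≤ m * (outerBoundary B).card := by exact_mod_cast h
    have h3 : κ * m ≤ (outerBoundary B).card := by
      refine le_of_mul_le_mul_left ?_ hm'
      linarith [hcompl]
    refine le_trans (mul_le_mul_of_nonneg_left ?_ hκ0) h3
    rw [Real.sqrt_le_left hm'.le]
    have : (0 : ℝ) ≤ κ * (m : ℝ) ^ 2 := by positivity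
    linarith
  by_cases hrow : ∀ i, ∃ j, (i, j) ∉ B
  · by_cases hcol : ∀ j, ∃ i, (i, j) ∉ B
    · have h := card_le_sq_card_outerBoundary B hrow hcol
      have h' : (B.card : ℝ) ≤ ((outerBoundary B).card : ℝ) ^ 2 := by exact_mod_cast h
      calc κ * √(B.card : ℝ) ≤ 1 * √(B.card : ℝ) := by gcongr
        _ = √(B.card : ℝ) := one_mul _
        _ ≤ _ := (Real.sqrt_le_left (Nat.cast_nonneg _)).2 h'
    · push Not at hcol
      obtain ⟨j, hj⟩ := hcol
      exact key (card_compl_le_of_column B hj)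
  · push Not at hrow
    obtain ⟨i, hi⟩ := hrow
    exact key (card_compl_le_of_row B hi)

end

/-! ### Expansion from a division into evenly filled cells -/

theorem mem_outNeighborhood {V : Type*} [Fintype V] {G : SimpleGraph V} {I : Finset V} {v : V} :
    v ∈ outNeighborhood G I ↔ v ∉ I ∧ ∃ u ∈ I, G.Adj u v := by
  simp [outNeighborhood]

section
open Classical
variable {V : Type*} {m : ℕ} {cell : V → Fin m × Fin m} {lo hi : ℝ}

theorem card_mul_le_card_of_fibers (D : Finset (Fin m × Fin m)) (s : Finset V)
    (h : ∀ C ∈ D, lo ≤ ((s.filter fun v => cell v = C).card : ℝ)) :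
    D.card * lo ≤ s.card := by
  have h1 : s.card = ∑ C, (s.filter fun v => cell v = C).card :=
    Finset.card_eq_sum_card_fiberwise fun _ _ => Finset.mem_coe.2 (Finset.mem_univ _)
  rw [h1, Nat.cast_sum, ← nsmul_eq_mul]
  refine (Finset.card_nsmul_le_sum D _ lo h).trans ?_
  exact Finset.sum_le_sum_of_subset_of_nonneg (Finset.subset_univ _) fun _ _ _ => Nat.cast_nonneg _

variable [Fintype V] {G : SimpleGraph V} {I : Finset V}

/-- The nodes of a cell that `I` meets either lie in `I` or neighbor `I`. -/
theorem sub_card_le_card_outNeighborhood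
    (hadj : ∀ u v, u ≠ v → cell u = cell v → G.Adj u v)
    (hlo : ∀ C, lo ≤ ((Finset.univ.filter fun v => cell v = C).card : ℝ)) (hI : I.Nonempty) :
    lo - I.card ≤ (outNeighborhood G I).card := by
  obtain ⟨u, hu⟩ := hI
  have hsub : (Finset.univ.filter fun v => cell v = cell u) ⊆ outNeighborhood G I ∪ I := by
    intro v hv
    by_cases hvI : v ∈ I
    · exact Finset.mem_union_right _ hvI
    · refine Finset.mem_union_left _ (mem_outNeighborhood.2 ⟨hvI, u, hu, hadj u v ?_ ?_⟩)
      · rintro rfl; exact hvI hu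
      · exact (Finset.mem_filter.1 hv).2.symm
  have h := (Finset.card_le_card hsub).trans (Finset.card_union_le _ _)
  have h' : ((Finset.univ.filter fun v => cell v = cell u).card : ℝ)
      ≤ (outNeighborhood G I).card + I.card := by exact_mod_cast h
  linarith [hlo (cell u)]

theorem card_le_card_mul_of_fibers (D : Finset (Fin m × Fin m)) (s : Finset V)
    (hs : ∀ v ∈ s, cell v ∈ D)
    (hhi : ∀ C, ((Finset.univ.filter fun v => cell v = C).card : ℝ) ≤ hi) :
    (s.card : ℝ) ≤ D.card * hi := by
  have h1 : s.card = ∑ C ∈ D, (s.filter fun v => cell v = C).card :=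
    Finset.card_eq_sum_card_fiberwise hs
  rw [h1, Nat.cast_sum, ← nsmul_eq_mul]
  refine Finset.sum_le_card_nsmul D _ hi fun C _ => le_trans ?_ (hhi C)
  exact_mod_cast Finset.card_le_card (Finset.filter_subset_filter _ (Finset.subset_univ _))

/-- Call a cell black if at least half of its nodes lie in `I`. The three alternatives are: at
most half of the cells that `I` meets are black; almost all cells of the grid are black; or the
isoperimetric inequality applies to the set of black cells. -/
theorem outNeighborhood_large_of_cells (hlo0 : 0 < lo)
    (hadj : ∀ u v, u ≠ v → (cell u = cell v ∨ IsNextTo (cell u) (cell v)) → G.Adj u v)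
    (hlo : ∀ C, lo ≤ ((Finset.univ.filter fun v => cell v = C).card : ℝ))
    (hhi : ∀ C, ((Finset.univ.filter fun v => cell v = C).card : ℝ) ≤ hi)
    (hI : I.Nonempty) (hhalf : (I.card : ℝ) ≤ Fintype.card V / 2) :
    I.card * (lo / (4 * hi)) ≤ (outNeighborhood G I).card ∨
      (Fintype.card V : ℝ) / 4 ≤ (outNeighborhood G I).card ∨
      lo / 2 * (lo / (4 * hi) * √(I.card / (2 * hi))) ≤ (outNeighborhood G I).card := by
  obtain ⟨u₀, hu₀⟩ := hI
  have hlohi : lo ≤ hi := (hlo (cell u₀)).trans (hhi (cell u₀))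
  have hhi0 : 0 < hi := hlo0.trans_le hlohi
  set N := outNeighborhood G I with hN
  set T := I.image cell with hT
  set B := Finset.univ.filter fun C : Fin m × Fin m =>
    (Finset.univ.filter fun v => cell v = C).card ≤ 2 * (I.filter fun v => cell v = C).card with hB
  have hBT : B ⊆ T := by
    intro C hC
    have h1 := (Finset.mem_filter.1 hC).2
    have h2 : 0 < (Finset.univ.filter fun v => cell v = C).card := by
      exact_mod_cast hlo0.trans_le (hlo C)
    obtain ⟨v, hv⟩ := Finset.card_pos.1 (show 0 < (I.filter fun v => cell v = C).card by omega)
    exact Finset.mem_image.2 ⟨v, (Finset.mem_filter.1 hv).1, (Finset.mem_filter.1 hv).2⟩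
  -- a node outside `I` in a cell that is met by `I`, or is next to such a cell, is a neighbor
  have hmem : ∀ v, v ∉ I → (cell v ∈ T ∨ ∃ D ∈ T, IsNextTo D (cell v)) → v ∈ N := by
    intro v hv h
    have : ∃ u ∈ I, cell u = cell v ∨ IsNextTo (cell u) (cell v) := by
      rcases h with h | ⟨D, hD, h⟩
      · obtain ⟨u, hu, huv⟩ := Finset.mem_image.1 h
        exact ⟨u, hu, Or.inl huv⟩
      · obtain ⟨u, hu, rfl⟩ := Finset.mem_image.1 hD
        exact ⟨u, hu, Or.inr h⟩
    obtain ⟨u, hu, huv⟩ := this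
    refine mem_outNeighborhood.2 ⟨hv, u, hu, hadj u v ?_ huv⟩
    rintro rfl
    exact hv hu
  have hcount : ∀ D : Finset (Fin m × Fin m),
      (∀ C ∈ D, C ∉ B ∧ (C ∈ T ∨ ∃ D ∈ T, IsNextTo D C)) → D.card * (lo / 2) ≤ N.card := by
    intro D hD
    refine card_mul_le_card_of_fibers (cell := cell) D N fun C hC => ?_
    obtain ⟨hCB, hCT⟩ := hD C hC
    have h1 : 2 * (I.filter fun v => cell v = C).card
        < (Finset.univ.filter fun v => cell v = C).card := by
      by_contra h
      exact hCB (Finset.mem_filter.2 ⟨Finset.mem_univ _, not_lt.1 h⟩)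
    have h2 : (Finset.univ.filter fun v => cell v = C).card
        ≤ (N.filter fun v => cell v = C).card + (I.filter fun v => cell v = C).card := by
      refine le_trans (Finset.card_le_card ?_) (Finset.card_union_le _ _)
      intro v hv
      have hvC := (Finset.mem_filter.1 hv).2
      by_cases hvI : v ∈ I
      · exact Finset.mem_union_right _ (Finset.mem_filter.2 ⟨hvI, hvC⟩)
      · refine Finset.mem_union_left _ (Finset.mem_filter.2 ⟨hmem v hvI ?_, hvC⟩)
        rwa [hvC]
    have h3 : (Finset.univ.filter fun v => cell v = C).card
        ≤ 2 * (N.filter fun v => cell v = C).card := by omega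
    have h3' : ((Finset.univ.filter fun v => cell v = C).card : ℝ)
        ≤ 2 * (N.filter fun v => cell v = C).card := by exact_mod_cast h3
    linarith [hlo C]
  have hIT : (I.card : ℝ) ≤ T.card * hi :=
    card_le_card_mul_of_fibers (cell := cell) T I (fun v hv => Finset.mem_image_of_mem _ hv) hhi
  by_cases hgray : 2 * B.card ≤ T.card
  · left
    have h1 := hcount (T \ B) fun C hC =>
      ⟨(Finset.mem_sdiff.1 hC).2, Or.inl (Finset.mem_sdiff.1 hC).1⟩
    have h2 : T.card ≤ 2 * (T \ B).card := by
      rw [Finset.card_sdiff_of_subset hBT]; omega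
    have h2' : (T.card : ℝ) ≤ 2 * (T \ B).card := by exact_mod_cast h2
    calc (I.card : ℝ) * (lo / (4 * hi)) ≤ T.card * hi * (lo / (4 * hi)) := by gcongr
      _ = T.card * (lo / 4) := by field_simp
      _ ≤ 2 * (T \ B).card * (lo / 4) := by gcongr
      _ = (T \ B).card * (lo / 2) := by ring
      _ ≤ N.card := h1
  right
  have hm2 : (m : ℝ) ^ 2 * lo ≤ Fintype.card V := by
    have := card_mul_le_card_of_fibers (cell := cell) (lo := lo) Finset.univ Finset.univ
      fun C _ => hlo C
    simpa [sq] using this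
  by_cases hκ : lo / (4 * hi) * (m : ℝ) ^ 2 ≤ (m : ℝ) ^ 2 - B.card
  · right
    have h1 := mul_sqrt_card_le_card_outerBoundary B (by positivity)
      ((div_le_one (by positivity)).2 (by linarith)) hκ
    have h2 := hcount (outerBoundary B) fun C hC => by
      obtain ⟨hCB, D, hD, hDC⟩ := (Finset.mem_filter.1 hC).2
      exact ⟨hCB, Or.inr ⟨D, hBT hD, hDC⟩⟩
    have h3 : (T.card : ℝ) ≤ 2 * B.card := by
      have : T.card ≤ 2 * B.card := by omega
      exact_mod_cast this
    have h4 : (I.card : ℝ) / (2 * hi) ≤ B.card := by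
      rw [div_le_iff₀ (by positivity)]
      nlinarith
    calc lo / 2 * (lo / (4 * hi) * √(I.card / (2 * hi)))
        ≤ lo / 2 * (lo / (4 * hi) * √(B.card : ℝ)) := by gcongr
      _ ≤ lo / 2 * (outerBoundary B).card := by gcongr
      _ = (outerBoundary B).card * (lo / 2) := mul_comm _ _
      _ ≤ N.card := h2
  · left
    push Not at hκ
    have h1 : ((Finset.univ.filter fun v => cell v ∉ B).card : ℝ) ≤ Bᶜ.card * hi :=
      card_le_card_mul_of_fibers (cell := cell) Bᶜ _
        (fun v hv => Finset.mem_compl.2 (Finset.mem_filter.1 hv).2) hhi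
    have h2 : (Bᶜ.card : ℝ) = (m : ℝ) ^ 2 - B.card := by
      rw [Finset.card_compl, Nat.cast_sub (Finset.card_le_univ B)]
      simp [sq]
    have h3 : ((Finset.univ.filter fun v => cell v ∉ B).card : ℝ) ≤ Fintype.card V / 4 := by
      calc ((Finset.univ.filter fun v => cell v ∉ B).card : ℝ) ≤ Bᶜ.card * hi := h1
        _ ≤ lo / (4 * hi) * (m : ℝ) ^ 2 * hi := by rw [h2]; gcongr
        _ = (m : ℝ) ^ 2 * lo / 4 := by field_simp
        _ ≤ _ := by gcongr
    have h4 : Fintype.card V ≤ N.card + I.card + (Finset.univ.filter fun v => cell v ∉ B).card := by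
      rw [← Finset.card_univ]
      refine le_trans (Finset.card_le_card ?_) ((Finset.card_union_le (N ∪ I) _).trans
        (Nat.add_le_add_right (Finset.card_union_le _ _) _))
      intro v _
      by_cases hvI : v ∈ I
      · simp [hvI]
      · by_cases hvB : cell v ∈ B
        · simp [hmem v hvI (Or.inl (hBT hvB))]
        · exact Finset.mem_union_right _ (Finset.mem_filter.2 ⟨Finset.mem_univ _, hvB⟩)
    have h4' : (Fintype.card V : ℝ) ≤ N.card + I.card
        + (Finset.univ.filter fun v => cell v ∉ B).card := by exact_mod_cast h4
    linarith

end

/-! ### Square cells of the grid -/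

/-- The intervals of length `k` that `{0, …, M - 1}` is divided into, where `m = M / k`; the last
one also takes the remaining `M % k` numbers. -/
def block {m : ℕ} (hm : 0 < m) (k i : ℕ) : Fin m := ⟨min (i / k) (m - 1), by omega⟩

theorem block_mul_le {m k : ℕ} (hm : 0 < m) (i : ℕ) : (block hm k i : ℕ) * k ≤ i :=
  (Nat.mul_le_mul_right k (min_le_left _ _)).trans (Nat.div_mul_le_self i k)

/-- The last block has at most `2 * k - 1` elements. The sharp bound, with `2` and not `1`, makes
neighboring blocks consecutive numbers when `k = 1`. -/
theorem add_two_le_block {M k : ℕ} (hm : 0 < M / k) {i : ℕ} (hi : i < M) :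
    i + 2 ≤ ((block hm k i : ℕ) + 2) * k := by
  have hk : 0 < k := by
    rcases Nat.eq_zero_or_pos k with rfl | h
    · simp at hm
    · exact h
  simp only [block]
  rcases le_total (i / k) (M / k - 1) with h | h
  · rw [min_eq_left h]
    have := Nat.lt_div_mul_add hk (a := i)
    linarith
  · rw [min_eq_right h]
    have h1 := Nat.lt_div_mul_add hk (a := M)
    have h2 : M / k - 1 + 2 = M / k + 1 := by omega
    rw [h2]
    linarith

theorem le_card_block {M k : ℕ} (hm : 0 < M / k) (j : Fin (M / k)) :
    k ≤ (Finset.univ.filter fun i : Fin M => block hm k i = j).card := by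
  have hjk : ∀ t : Fin k, (j : ℕ) * k + t < M := fun t => by
    have h1 : ((j : ℕ) + 1) * k ≤ M / k * k := Nat.mul_le_mul_right k j.2
    have h2 := Nat.div_mul_le_self M k
    have h3 := t.2
    linarith
  calc k = (Finset.univ : Finset (Fin k)).card := by simp
    _ ≤ _ := Finset.card_le_card_of_injOn (fun t => ⟨(j : ℕ) * k + t, hjk t⟩) ?_ ?_
  · intro t _
    simp only [Finset.coe_filter, Finset.mem_univ, true_and, Set.mem_ofPred_eq]
    refine Fin.ext ?_
    have hj := j.2
    have : ((j : ℕ) * k + t) / k = j := by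
      rw [mul_comm, Nat.mul_add_div (Fin.pos t), Nat.div_eq_of_lt t.2, add_zero]
    simp only [block, this]
    omega
  · intro t _ t' _ h
    simp only [Fin.mk.injEq] at h
    exact Fin.ext (by omega)

theorem card_block_le {M k : ℕ} (hm : 0 < M / k) (j : Fin (M / k)) :
    (Finset.univ.filter fun i : Fin M => block hm k i = j).card ≤ 2 * k := by
  have h : ∀ i : Fin M, block hm k i = j → (j : ℕ) * k ≤ i ∧ (i : ℕ) + 2 ≤ (j : ℕ) * k + 2 * k := by
    rintro i rfl
    exact ⟨block_mul_le hm i, by linarith [add_two_le_block hm i.2]⟩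
  calc (Finset.univ.filter fun i : Fin M => block hm k i = j).card
      ≤ (Finset.range (2 * k)).card :=
        Finset.card_le_card_of_injOn (fun i => (i : ℕ) - (j : ℕ) * k) ?_ ?_
    _ = 2 * k := Finset.card_range _
  · intro i hi
    have := h i (Finset.mem_filter.1 hi).2
    simp only [Finset.coe_range, Set.mem_Iio]
    omega
  · intro i hi i' hi' hii
    have h1 := h i (Finset.mem_filter.1 hi).2
    have h2 := h i' (Finset.mem_filter.1 hi').2
    simp only at hii
    exact Fin.ext (by omega)

section
variable {n : ℕ} {ε r R : ℝ} {k : ℕ}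

/-- The square cell of a grid position; the cells form an `m × m` grid. -/
noncomputable def gridCell (hm : 0 < (⌊√(n : ℝ) / ε⌋₊ + 1) / k) (x : GridPos n ε) :
    Fin ((⌊√(n : ℝ) / ε⌋₊ + 1) / k) × Fin ((⌊√(n : ℝ) / ε⌋₊ + 1) / k) :=
  (block hm k x.1, block hm k x.2)

theorem card_gridCell (hm : 0 < (⌊√(n : ℝ) / ε⌋₊ + 1) / k)
    (C : Fin ((⌊√(n : ℝ) / ε⌋₊ + 1) / k) × Fin ((⌊√(n : ℝ) / ε⌋₊ + 1) / k)) :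
    k ^ 2 ≤ (Finset.univ.filter fun x : GridPos n ε => gridCell hm x = C).card ∧
      (Finset.univ.filter fun x : GridPos n ε => gridCell hm x = C).card ≤ 4 * k ^ 2 := by
  have h : (Finset.univ.filter fun x : GridPos n ε => gridCell hm x = C) =
      (Finset.univ.filter fun i : Fin (⌊√(n : ℝ) / ε⌋₊ + 1) => block hm k i = C.1) ×ˢ
        (Finset.univ.filter fun i : Fin (⌊√(n : ℝ) / ε⌋₊ + 1) => block hm k i = C.2) := by
    ext x
    simp [gridCell, Prod.ext_iff]
  rw [h, Finset.card_product]
  constructor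
  · rw [sq]
    exact Nat.mul_le_mul (le_card_block hm _) (le_card_block hm _)
  · calc _ ≤ 2 * k * (2 * k) := Nat.mul_le_mul (card_block_le hm _) (card_block_le hm _)
      _ = _ := by ring

theorem sq_sub_le_of_block_eq {M : ℕ} (hm : 0 < M / k) {i j : ℕ} (hi : i < M) (hj : j < M)
    (h : block hm k i = block hm k j) : ((i : ℝ) - j) ^ 2 ≤ (2 * k - 2) ^ 2 := by
  have h1 := block_mul_le (k := k) hm i
  have h2 := add_two_le_block hm hi
  have h3 := block_mul_le (k := k) hm j
  have h4 := add_two_le_block hm hj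
  rw [h] at h1 h2
  have h1' : ((block hm k j : ℕ) : ℝ) * k ≤ i := by exact_mod_cast h1
  have h2' : (i : ℝ) + 2 ≤ ((block hm k j : ℕ) + 2) * k := by exact_mod_cast h2
  have h3' : ((block hm k j : ℕ) : ℝ) * k ≤ j := by exact_mod_cast h3
  have h4' : (j : ℝ) + 2 ≤ ((block hm k j : ℕ) + 2) * k := by exact_mod_cast h4
  exact sq_le_sq' (by linarith) (by linarith)

theorem sq_sub_le_of_block_succ {M : ℕ} (hm : 0 < M / k) {i j : ℕ} (hi : i < M) (hj : j < M)
    (h : (block hm k i : ℕ) + 1 = block hm k j ∨ (block hm k j : ℕ) + 1 = block hm k i) :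
    ((i : ℝ) - j) ^ 2 ≤ (3 * k - 2) ^ 2 := by
  wlog h' : (block hm k i : ℕ) + 1 = block hm k j generalizing i j
  · have := this hj hi h.symm (h.resolve_left h')
    rwa [← neg_sub, neg_sq] at this
  have h1 := block_mul_le (k := k) hm i
  have h2 := add_two_le_block hm hi
  have h3 := block_mul_le (k := k) hm j
  have h4 := add_two_le_block hm hj
  rw [← h'] at h3 h4
  have h1' : ((block hm k i : ℕ) : ℝ) * k ≤ i := by exact_mod_cast h1
  have h2' : (i : ℝ) + 2 ≤ ((block hm k i : ℕ) + 2) * k := by exact_mod_cast h2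
  have h3' : ((block hm k i : ℕ) + 1 : ℝ) * k ≤ j := by exact_mod_cast h3
  have h4' : (j : ℝ) + 2 ≤ ((block hm k i : ℕ) + 1 + 2) * k := by exact_mod_cast h4
  have hk : (0 : ℝ) ≤ k := Nat.cast_nonneg k
  exact sq_le_sq' (by linarith) (by linarith)

/-- Positions in equal or neighboring cells are within distance `R`. If `4 * k * ε ≤ R` fails, the
cells have to be single positions, because `R` can be as small as the mesh `ε`. -/
theorem dist_le_of_gridCell (hε : 0 < ε) (hk0 : 0 < k)
    (hk : (k = 1 ∧ ε ≤ R) ∨ 4 * (k * ε) ≤ R)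
    (hm : 0 < (⌊√(n : ℝ) / ε⌋₊ + 1) / k) {x y : GridPos n ε}
    (h : gridCell hm x = gridCell hm y ∨ IsNextTo (gridCell hm x) (gridCell hm y)) :
    dist (point x) (point y) ≤ R := by
  have hk1 : (1 : ℝ) ≤ k := by exact_mod_cast hk0
  have hsq : (2 * (k : ℝ) - 2) ^ 2 ≤ (3 * k - 2) ^ 2 := sq_le_sq' (by linarith) (by linarith)
  have hsum : (((x.1 : ℕ) : ℝ) - (y.1 : ℕ)) ^ 2 + (((x.2 : ℕ) : ℝ) - (y.2 : ℕ)) ^ 2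
      ≤ (3 * (k : ℝ) - 2) ^ 2 + (2 * k - 2) ^ 2 := by
    rcases h with h | ⟨h1, h2⟩ | ⟨h1, h2⟩
    · have h1 := sq_sub_le_of_block_eq hm x.1.2 y.1.2 (congrArg Prod.fst h)
      have h2 := sq_sub_le_of_block_eq hm x.2.2 y.2.2 (congrArg Prod.snd h)
      linarith
    · have h1 := sq_sub_le_of_block_eq hm x.1.2 y.1.2 h1
      have h2 := sq_sub_le_of_block_succ hm x.2.2 y.2.2 h2
      linarith
    · have h1 := sq_sub_le_of_block_eq hm x.2.2 y.2.2 h1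
      have h2 := sq_sub_le_of_block_succ hm x.1.2 y.1.2 h2
      linarith
  rw [dist_point hε.le]
  refine le_trans (mul_le_mul_of_nonneg_right (Real.sqrt_le_sqrt hsum) hε.le) ?_
  rcases hk with ⟨rfl, hR⟩ | hR
  · norm_num
    exact hR
  · refine le_trans ?_ hR
    rw [← mul_assoc]
    refine mul_le_mul_of_nonneg_right ?_ hε.le
    rw [Real.sqrt_le_left (by positivity)]
    nlinarith

/-- The cell side used below: about `R / (4 * ε)` grid steps, but at least one. The
last two bounds say that `n` points spread uniformly put between `R ^ 2 / 256` and `R ^ 2` of them,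
on average, into a `k × k` square of the grid. -/
theorem exists_cell_side (hε : 0 < ε) (hεR : ε < R) (hRn : R ≤ √(n : ℝ)) :
    ∃ k : ℕ, 0 < k ∧ ((k = 1 ∧ ε ≤ R) ∨ 4 * (k * ε) ≤ R) ∧
      0 < (⌊√(n : ℝ) / ε⌋₊ + 1) / k ∧
      R ^ 2 / 256 * ((⌊√(n : ℝ) / ε⌋₊ : ℝ) + 1) ^ 2 ≤ n * (k : ℝ) ^ 2 ∧
      n * (k : ℝ) ^ 2 ≤ R ^ 2 * ((⌊√(n : ℝ) / ε⌋₊ : ℝ) + 1) ^ 2 := by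
  have hR : 0 < R := hε.trans hεR
  have hs : 0 < √(n : ℝ) := hR.trans_le hRn
  have hsn : √(n : ℝ) ^ 2 = n := Real.sq_sqrt (Nat.cast_nonneg n)
  have hN1 : (⌊√(n : ℝ) / ε⌋₊ : ℝ) * ε ≤ √(n : ℝ) := by
    rw [← le_div_iff₀ hε]
    exact Nat.floor_le (by positivity)
  have hN2 : √(n : ℝ) < ((⌊√(n : ℝ) / ε⌋₊ : ℝ) + 1) * ε := by
    rw [← div_lt_iff₀ hε]
    exact Nat.lt_floor_add_one _
  have hf1 : 4 * ((⌊R / (4 * ε)⌋₊ : ℝ) * ε) ≤ R := by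
    have := Nat.floor_le (show 0 ≤ R / (4 * ε) by positivity)
    rw [le_div_iff₀ (by positivity)] at this
    linarith
  have hf2 : R < ((⌊R / (4 * ε)⌋₊ : ℝ) + 1) * (4 * ε) := by
    rw [← div_lt_iff₀ (by positivity)]
    exact Nat.lt_floor_add_one _
  obtain ⟨k, hk0, hk, hk8⟩ : ∃ k : ℕ, 0 < k ∧ ((k = 1 ∧ ε ≤ R) ∨ 4 * (k * ε) ≤ R) ∧
      R ≤ 8 * (k * ε) := by
    rcases Nat.eq_zero_or_pos ⌊R / (4 * ε)⌋₊ with h | h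
    · refine ⟨1, one_pos, Or.inl ⟨rfl, hεR.le⟩, ?_⟩
      rw [h] at hf2
      push_cast at hf2 ⊢
      linarith
    · refine ⟨_, h, Or.inr hf1, ?_⟩
      have h' : (1 : ℝ) ≤ (⌊R / (4 * ε)⌋₊ : ℝ) := by exact_mod_cast h
      nlinarith
  have hkR : k * ε ≤ R := by
    rcases hk with ⟨rfl, h⟩ | h
    · simpa using h
    · have : 0 ≤ (k : ℝ) * ε := by positivity
      linarith
  generalize ⌊√(n : ℝ) / ε⌋₊ = N at *
  refine ⟨k, hk0, hk, ?_, ?_, ?_⟩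
  · refine Nat.div_pos ?_ hk0
    have : (k : ℝ) ≤ N + 1 := le_of_mul_le_mul_right (by linarith) hε
    exact_mod_cast this
  · have h1 : ((N : ℝ) + 1) * ε ≤ 2 * √(n : ℝ) := by linarith
    have h2 : R / 16 * (N + 1) ≤ √(n : ℝ) * k := by
      refine le_of_mul_le_mul_right ?_ hε
      calc R / 16 * (N + 1) * ε = R / 16 * ((N + 1) * ε) := by ring
        _ ≤ 8 * (k * ε) / 16 * (2 * √(n : ℝ)) := by gcongr
        _ = _ := by ring
    have h3 := pow_le_pow_left₀ (by positivity) h2 2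
    rw [mul_pow, mul_pow, hsn] at h3
    linarith [h3]
  · have h2 : √(n : ℝ) * k ≤ R * (N + 1) := by
      refine le_of_mul_le_mul_right ?_ hε
      calc √(n : ℝ) * k * ε = √(n : ℝ) * (k * ε) := by ring
        _ ≤ ((N + 1) * ε) * R := by gcongr
        _ = _ := by ring
    have h3 := pow_le_pow_left₀ (by positivity) h2 2
    rwa [mul_pow, mul_pow, hsn] at h3

/-- The expected number of nodes in each cell is of order `R ^ 2`. -/
theorem cell_mass_bounds (hε : 0 < ε) (hr : 0 ≤ r) (hm : 0 < (⌊√(n : ℝ) / ε⌋₊ + 1) / k)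
    (h1 : R ^ 2 / 256 * ((⌊√(n : ℝ) / ε⌋₊ : ℝ) + 1) ^ 2 ≤ n * (k : ℝ) ^ 2)
    (h2 : n * (k : ℝ) ^ 2 ≤ R ^ 2 * ((⌊√(n : ℝ) / ε⌋₊ : ℝ) + 1) ^ 2)
    (C : Fin ((⌊√(n : ℝ) / ε⌋₊ + 1) / k) × Fin ((⌊√(n : ℝ) / ε⌋₊ + 1) / k)) :
    R ^ 2 / 4096 ≤ n * ∑ x : GridPos n ε with gridCell hm x = C, nodeStationary r x ∧
      n * ∑ x : GridPos n ε with gridCell hm x = C, nodeStationary r x ≤ 64 * R ^ 2 := by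
  obtain ⟨hc1, hc2⟩ := card_gridCell hm C
  have hc1' : (k : ℝ) ^ 2
      ≤ (Finset.univ.filter fun x : GridPos n ε => gridCell hm x = C).card := by exact_mod_cast hc1
  have hc2' : ((Finset.univ.filter fun x : GridPos n ε => gridCell hm x = C).card : ℝ)
      ≤ 4 * (k : ℝ) ^ 2 := by exact_mod_cast hc2
  have hcard : (Fintype.card (GridPos n ε) : ℝ) = ((⌊√(n : ℝ) / ε⌋₊ : ℝ) + 1) ^ 2 := by
    simp [sq]
  have hlo := Finset.card_nsmul_le_sum (Finset.univ.filter fun x : GridPos n ε => gridCell hm x = C)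
    (nodeStationary r) _ fun x _ => le_nodeStationary hε hr x
  have hhi := Finset.sum_le_card_nsmul (Finset.univ.filter fun x : GridPos n ε => gridCell hm x = C)
    (nodeStationary r) _ fun x _ => nodeStationary_le hε hr x
  rw [nsmul_eq_mul, hcard] at hlo hhi
  have hM : (0 : ℝ) < ((⌊√(n : ℝ) / ε⌋₊ : ℝ) + 1) ^ 2 := by positivity
  constructor
  · calc R ^ 2 / 4096 = R ^ 2 / 256 * ((⌊√(n : ℝ) / ε⌋₊ : ℝ) + 1) ^ 2 *
          (1 / (16 * ((⌊√(n : ℝ) / ε⌋₊ : ℝ) + 1) ^ 2)) := by field_simp; ring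
      _ ≤ n * (k : ℝ) ^ 2 * (1 / (16 * ((⌊√(n : ℝ) / ε⌋₊ : ℝ) + 1) ^ 2)) := by gcongr
      _ ≤ n * ((Finset.univ.filter fun x : GridPos n ε => gridCell hm x = C).card : ℝ) *
          (1 / (16 * ((⌊√(n : ℝ) / ε⌋₊ : ℝ) + 1) ^ 2)) := by gcongr
      _ = n * (((Finset.univ.filter fun x : GridPos n ε => gridCell hm x = C).card : ℝ) *
          (1 / (16 * ((⌊√(n : ℝ) / ε⌋₊ : ℝ) + 1) ^ 2))) := mul_assoc _ _ _
      _ ≤ _ := by gcongr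
  · calc n * ∑ x : GridPos n ε with gridCell hm x = C, nodeStationary r x
        ≤ n * (4 * (k : ℝ) ^ 2 * (16 / ((⌊√(n : ℝ) / ε⌋₊ : ℝ) + 1) ^ 2)) := by
          refine mul_le_mul_of_nonneg_left (hhi.trans ?_) (Nat.cast_nonneg n)
          gcongr
      _ = n * (k : ℝ) ^ 2 * (64 / ((⌊√(n : ℝ) / ε⌋₊ : ℝ) + 1) ^ 2) := by ring
      _ ≤ R ^ 2 * ((⌊√(n : ℝ) / ε⌋₊ : ℝ) + 1) ^ 2 *
          (64 / ((⌊√(n : ℝ) / ε⌋₊ : ℝ) + 1) ^ 2) := by gcongr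
      _ = 64 * R ^ 2 := by field_simp

end

/-! ### Expansion when each cell holds about `R ^ 2` nodes -/

section
variable {V : Type*} [Fintype V] {G : SimpleGraph V} {m : ℕ} {cell : V → Fin m × Fin m} {R : ℝ}

theorem isExpander_small (hR : 0 < R)
    (hadj : ∀ u v, u ≠ v → cell u = cell v → G.Adj u v)
    (hlo : ∀ C, R ^ 2 / 16384 ≤ ((Finset.univ.filter fun v => cell v = C).card : ℝ))
    {h : ℝ} (h1 : 1 ≤ h) (h2 : h ≤ 1 / 32768 * R ^ 2) :
    IsExpander G h (1 / 32768 * R ^ 2 / h) := by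
  intro I hI
  have h0 : 0 < h := one_pos.trans_le h1
  rcases I.eq_empty_or_nonempty with rfl | hne
  · simp
  have hN := sub_card_le_card_outNeighborhood hadj hlo hne
  calc 1 / 32768 * R ^ 2 / h * I.card ≤ 1 / 32768 * R ^ 2 / h * h := by gcongr
    _ = 1 / 32768 * R ^ 2 := by field_simp
    _ ≤ _ := by linarith

/-- Since `|I| / √h ≤ √|I|` whenever `|I| ≤ h`, this is the second expansion property for `I` in
its strongest form. Here `1 / 8454144` is `lo / (4 * hi)` for the occupation bounds
`lo = R ^ 2 / 16384` and `hi = 129 * R ^ 2`, and `β = 1 / 10 ^ 13` is small enough for each of the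
three cases of `outNeighborhood_large_of_cells`. -/
theorem mul_sqrt_card_le_card_outNeighborhood (hR : 0 < R)
    (hRn : R ≤ √(Fintype.card V : ℝ))
    (hadj : ∀ u v, u ≠ v → (cell u = cell v ∨ IsNextTo (cell u) (cell v)) → G.Adj u v)
    (hlo : ∀ C, R ^ 2 / 16384 ≤ ((Finset.univ.filter fun v => cell v = C).card : ℝ))
    (hhi : ∀ C, ((Finset.univ.filter fun v => cell v = C).card : ℝ) ≤ 129 * R ^ 2)
    {I : Finset V} (hI : 1 / 32768 * R ^ 2 ≤ I.card)
    (hhalf : (I.card : ℝ) ≤ Fintype.card V / 2) :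
    1 / 10 ^ 13 * R * √(I.card : ℝ) ≤ (outNeighborhood G I).card := by
  have hne : I.Nonempty := by
    rw [← Finset.card_pos]
    have : (0 : ℝ) < I.card := lt_of_lt_of_le (by positivity) hI
    exact_mod_cast this
  have hρ : R ^ 2 / 16384 / (4 * (129 * R ^ 2)) = 1 / 8454144 := by
    field_simp
    norm_num
  have hs0 : 0 ≤ √(I.card : ℝ) := Real.sqrt_nonneg _
  have hs : √(I.card : ℝ) * √(I.card : ℝ) = I.card := Real.mul_self_sqrt (Nat.cast_nonneg _)
  have hRs : 0 ≤ R * √(I.card : ℝ) := by positivity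
  rcases outNeighborhood_large_of_cells (by positivity) hadj hlo hhi hne hhalf with h | h | h
  · refine le_trans ?_ h
    rw [hρ]
    have h1 : R / 200 ≤ √(I.card : ℝ) := by
      refine Real.le_sqrt_of_sq_le (le_trans ?_ hI)
      rw [div_pow]
      linarith [sq_nonneg R]
    have h2 := mul_le_mul_of_nonneg_right h1 hs0
    rw [hs] at h2
    linarith
  · refine le_trans ?_ h
    have h1 : √(I.card : ℝ) ≤ √(Fintype.card V : ℝ) := Real.sqrt_le_sqrt (by
      have : (0 : ℝ) ≤ Fintype.card V := Nat.cast_nonneg _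
      linarith)
    have h2 := mul_le_mul hRn h1 hs0 (Real.sqrt_nonneg _)
    rw [Real.mul_self_sqrt (Nat.cast_nonneg _)] at h2
    linarith
  · refine le_trans ?_ h
    rw [hρ]
    have h1 : √(I.card : ℝ) / (17 * R) ≤ √(I.card / (2 * (129 * R ^ 2))) := by
      refine Real.le_sqrt_of_sq_le ?_
      rw [div_pow, mul_pow, Real.sq_sqrt (Nat.cast_nonneg _)]
      refine div_le_div_of_nonneg_left (Nat.cast_nonneg _) (by positivity) ?_
      linarith [sq_nonneg R]
    calc 1 / 10 ^ 13 * R * √(I.card : ℝ) = 1 / 10 ^ 13 * (R * √(I.card : ℝ)) := by ring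
      _ ≤ 1 / (32768 * 8454144 * 17) * (R * √(I.card : ℝ)) := by gcongr; norm_num
      _ = R ^ 2 / 16384 / 2 * (1 / 8454144 * (√(I.card : ℝ) / (17 * R))) := by
        field_simp; norm_num
      _ ≤ _ := by gcongr

theorem isExpander_large (hR : 0 < R)
    (hRn : R ≤ √(Fintype.card V : ℝ))
    (hadj : ∀ u v, u ≠ v → (cell u = cell v ∨ IsNextTo (cell u) (cell v)) → G.Adj u v)
    (hlo : ∀ C, R ^ 2 / 16384 ≤ ((Finset.univ.filter fun v => cell v = C).card : ℝ))
    (hhi : ∀ C, ((Finset.univ.filter fun v => cell v = C).card : ℝ) ≤ 129 * R ^ 2)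
    {h : ℝ} (h1 : 1 / 32768 * R ^ 2 ≤ h) (h2 : h ≤ (Fintype.card V : ℝ) / 2) :
    IsExpander G h (1 / 10 ^ 13 * R / √h) := by
  intro I hI
  rcases I.eq_empty_or_nonempty with rfl | hne
  · simp
  have hh : 0 < h := lt_of_lt_of_le (by positivity) h1
  have hsh : 0 < √h := Real.sqrt_pos.2 hh
  rw [div_mul_eq_mul_div, div_le_iff₀ hsh]
  rcases le_total (I.card : ℝ) (1 / 32768 * R ^ 2) with hsmall | hlarge
  · have hN := sub_card_le_card_outNeighborhood (fun u v huv hc => hadj u v huv (Or.inl hc)) hlo hne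
    have h3 : R / 200 ≤ √h := by
      refine Real.le_sqrt_of_sq_le (le_trans ?_ h1)
      rw [div_pow]
      linarith [sq_nonneg R]
    calc 1 / 10 ^ 13 * R * I.card ≤ 1 / 10 ^ 13 * R * (outNeighborhood G I).card := by
          exact mul_le_mul_of_nonneg_left (by linarith) (by positivity)
      _ ≤ R / 200 * (outNeighborhood G I).card := by gcongr; linarith
      _ ≤ √h * (outNeighborhood G I).card := by gcongr
      _ = _ := mul_comm _ _
  · have hN := mul_sqrt_card_le_card_outNeighborhood hR hRn hadj hlo hhi hlarge (hI.trans h2)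
    calc 1 / 10 ^ 13 * R * (I.card : ℝ)
        = 1 / 10 ^ 13 * R * √(I.card : ℝ) * √(I.card : ℝ) := by
          rw [mul_assoc _ (√_), Real.mul_self_sqrt (Nat.cast_nonneg _)]
      _ ≤ (outNeighborhood G I).card * √h := by gcongr

end

/-! ### Expansion of the stationary graph -/

section
variable {n : ℕ} {ε r R : ℝ} {k : ℕ}

/-- All the cells hold about `R ^ 2` nodes with high probability; `Sum.inl` indexes the cells
that hold too few nodes, `Sum.inr` those that hold too many. -/
theorem sum_prob_bad_cells_le (hn : 2 ≤ n) (hε : 0 < ε) (hr : 0 ≤ r) (hk0 : 0 < k)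
    (hcR : 256 * √(Real.log (n : ℝ)) ≤ R)
    (hm : 0 < (⌊√(n : ℝ) / ε⌋₊ + 1) / k)
    (h1 : R ^ 2 / 256 * ((⌊√(n : ℝ) / ε⌋₊ : ℝ) + 1) ^ 2 ≤ n * (k : ℝ) ^ 2)
    (h2 : n * (k : ℝ) ^ 2 ≤ R ^ 2 * ((⌊√(n : ℝ) / ε⌋₊ : ℝ) + 1) ^ 2) :
    ∑ C : (Fin ((⌊√(n : ℝ) / ε⌋₊ + 1) / k) × Fin ((⌊√(n : ℝ) / ε⌋₊ + 1) / k)) ⊕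
        (Fin ((⌊√(n : ℝ) / ε⌋₊ + 1) / k) × Fin ((⌊√(n : ℝ) / ε⌋₊ + 1) / k)),
      prob (fun X : Config n ε => ∏ i, nodeStationary r (X i))
        (Sum.elim
          (fun C X => -(R ^ 2 / 16384) ≤ -1 * ((Finset.univ.filter fun i =>
            gridCell hm (X i) = C).card : ℝ))
          (fun C X => 129 * R ^ 2 ≤ 1 * ((Finset.univ.filter fun i =>
            gridCell hm (X i) = C).card : ℝ)) C)
      ≤ 1 / (n : ℝ) ^ 2 := by
  have hn' : (2 : ℝ) ≤ n := by exact_mod_cast hn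
  have hn0 : (0 : ℝ) < n := by linarith
  have hlog2 : (1 : ℝ) / 2 ≤ Real.log n := by
    have h3 := Real.log_le_log (by norm_num) hn'
    linarith [Real.log_two_gt_d9]
  have hR2 : 65536 * Real.log n ≤ R ^ 2 := by
    have := pow_le_pow_left₀ (by positivity) hcR 2
    rw [mul_pow, Real.sq_sqrt (by linarith)] at this
    linarith
  have hexp : Real.exp (-(R ^ 2 / 16384)) ≤ 1 / (n : ℝ) ^ 4 := by
    have h3 : Real.exp (4 * Real.log n) = (n : ℝ) ^ 4 := by
      have := Real.exp_nat_mul (Real.log n) 4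
      rw [Real.exp_log hn0] at this
      exact_mod_cast this
    rw [← h3, one_div, ← Real.exp_neg]
    exact Real.exp_le_exp.2 (by linarith)
  -- there are `m ^ 2 ≤ n` cells
  have hmn : (((⌊√(n : ℝ) / ε⌋₊ + 1) / k : ℕ) : ℝ) * (((⌊√(n : ℝ) / ε⌋₊ + 1) / k : ℕ) : ℝ) ≤ n := by
    have hk : (0 : ℝ) < k := by exact_mod_cast hk0
    have h3 : (((⌊√(n : ℝ) / ε⌋₊ + 1) / k : ℕ) : ℝ) ≤ ((⌊√(n : ℝ) / ε⌋₊ : ℝ) + 1) / k := by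
      have := @Nat.cast_div_le ℝ _ _ _ (⌊√(n : ℝ) / ε⌋₊ + 1) k
      exact_mod_cast this
    calc _ ≤ (((⌊√(n : ℝ) / ε⌋₊ : ℝ) + 1) / k) * (((⌊√(n : ℝ) / ε⌋₊ : ℝ) + 1) / k) := by gcongr
      _ = ((⌊√(n : ℝ) / ε⌋₊ : ℝ) + 1) ^ 2 / (k : ℝ) ^ 2 := by ring
      _ ≤ n := by
        rw [div_le_iff₀ (by positivity)]
        refine le_trans ?_ h1
        refine le_mul_of_one_le_left (by positivity) ?_
        linarith
  have hbad : ∀ C : Fin ((⌊√(n : ℝ) / ε⌋₊ + 1) / k) × Fin ((⌊√(n : ℝ) / ε⌋₊ + 1) / k),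
      prob (fun X : Config n ε => ∏ i, nodeStationary r (X i))
        (fun X => -(R ^ 2 / 16384) ≤ -1 * ((Finset.univ.filter fun i =>
            gridCell hm (X i) = C).card : ℝ))
        ≤ 1 / (n : ℝ) ^ 4 ∧
      prob (fun X : Config n ε => ∏ i, nodeStationary r (X i))
        (fun X => 129 * R ^ 2 ≤ 1 * ((Finset.univ.filter fun i =>
            gridCell hm (X i) = C).card : ℝ))
        ≤ 1 / (n : ℝ) ^ 4 := by
    intro C
    obtain ⟨hlo, hhi⟩ := cell_mass_bounds hε hr hm h1 h2 C
    have hR0 := sq_nonneg R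
    constructor
    · refine (prob_card_le_exp (gridCell hm) C (fun x => (nodeStationary_pos hr x).le)
        (sum_nodeStationary hr) n _ _).trans (le_trans (Real.exp_le_exp.2 ?_) hexp)
      have he : Real.exp (-1) ≤ 1 / 2 := by
        rw [Real.exp_neg, ← one_div]
        exact one_div_le_one_div_of_le two_pos (by linarith [Real.exp_one_gt_d9])
      nlinarith
    · refine (prob_card_le_exp (gridCell hm) C (fun x => (nodeStationary_pos hr x).le)
        (sum_nodeStationary hr) n _ _).trans (le_trans (Real.exp_le_exp.2 ?_) hexp)
      have he : Real.exp 1 ≤ 3 := by linarith [Real.exp_one_lt_d9]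
      have he1 : 1 ≤ Real.exp 1 := Real.one_le_exp zero_le_one
      nlinarith
  rw [Fintype.sum_sum_type, ← Finset.sum_add_distrib]
  calc _ ≤ ∑ C : Fin ((⌊√(n : ℝ) / ε⌋₊ + 1) / k) × Fin ((⌊√(n : ℝ) / ε⌋₊ + 1) / k),
          (1 / (n : ℝ) ^ 4 + 1 / (n : ℝ) ^ 4) :=
        Finset.sum_le_sum fun C _ => add_le_add (hbad C).1 (hbad C).2
    _ = (((⌊√(n : ℝ) / ε⌋₊ + 1) / k : ℕ) : ℝ) * (((⌊√(n : ℝ) / ε⌋₊ + 1) / k : ℕ) : ℝ) *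
          (2 * (1 / (n : ℝ) ^ 4)) := by
        simp only [Finset.sum_const, Finset.card_univ, Fintype.card_prod, Fintype.card_fin,
          nsmul_eq_mul, Nat.cast_mul]
        ring
    _ ≤ n * (n * (1 / (n : ℝ) ^ 4)) := by gcongr
    _ = 1 / (n : ℝ) ^ 2 := by field_simp

end

end GeometricMEG

theorem mainTheorem3 :
    ∃ c : ℝ, 0 < c ∧ ∃ α : ℝ, 0 < α ∧ ∃ β : ℝ, 0 < β ∧
      ∀ (n : ℕ) (r R ε : ℝ), 0 ≤ r → 0 < ε → ε ≤ 1 → ε < R →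
        c * √(Real.log (n : ℝ)) ≤ R → R ≤ √(n : ℝ) →
        ∀ π : GeometricMEG.Config n ε → ℝ, GeometricMEG.IsStationaryLaw r π →
          1 - 1 / (n : ℝ) ^ 2 ≤ GeometricMEG.prob π (fun X =>
            (∀ h : ℝ, 1 ≤ h → h ≤ α * R ^ 2 →
              GeometricMEG.IsExpander (GeometricMEG.graph R X) h (α * R ^ 2 / h)) ∧
            (∀ h : ℝ, α * R ^ 2 ≤ h → h ≤ (n : ℝ) / 2 →
              GeometricMEG.IsExpander (GeometricMEG.graph R X) h (β * R / √h))) := by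
  -- `c ^ 2 = 65536` makes the Chernoff bound `exp (-R ^ 2 / 16384)` at most `1 / n ^ 4`, and
  -- `α * R ^ 2` is half of the lower bound `R ^ 2 / 16384` on the occupation of a cell
  refine ⟨256, by norm_num, 1 / 32768, by norm_num, 1 / 10 ^ 13, by norm_num, ?_⟩
  intro n r R ε hr hε _ hεR hcR hRn π hπ
  have hR : 0 < R := hε.trans hεR
  rcases lt_or_ge n 2 with hn | hn
  · -- `1 - 1 / n ^ 2` vanishes for `n = 1`, and `n = 0` contradicts `0 < R ≤ √n`
    have hn1 : n = 1 := by
      have : n ≠ 0 := by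
        rintro rfl
        simp at hRn
        linarith
      omega
    subst hn1
    simpa using GeometricMEG.prob_nonneg hπ.stationary.nonneg _
  obtain ⟨k, hk0, hk, hm, h1, h2⟩ := GeometricMEG.exists_cell_side hε hεR hRn
  have hbad := GeometricMEG.sum_prob_bad_cells_le hn hε hr hk0 hcR hm h1 h2
  rw [← hπ.eq_prod hε hr] at hbad
  refine (sub_le_sub_left hbad 1).trans
    (GeometricMEG.one_sub_sum_le_prob hπ.stationary.nonneg hπ.stationary.sum_eq_one ?_)
  intro X hX
  by_contra! hgood
  refine hX ?_
  have hlo : ∀ C, R ^ 2 / 16384 ≤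
      ((Finset.univ.filter fun i => GeometricMEG.gridCell hm (X i) = C).card : ℝ) := fun C => by
    have := hgood (Sum.inl C)
    simp only [Sum.elim_inl, not_le] at this
    linarith
  have hhi : ∀ C, ((Finset.univ.filter fun i => GeometricMEG.gridCell hm (X i) = C).card : ℝ)
      ≤ 129 * R ^ 2 := fun C => by
    have := hgood (Sum.inr C)
    simp only [Sum.elim_inr, not_le] at this
    linarith
  have hadj : ∀ u v, u ≠ v → (GeometricMEG.gridCell hm (X u) = GeometricMEG.gridCell hm (X v) ∨
      GeometricMEG.IsNextTo (GeometricMEG.gridCell hm (X u)) (GeometricMEG.gridCell hm (X v))) →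
      (GeometricMEG.graph R X).Adj u v := fun u v huv h =>
    ⟨huv, GeometricMEG.dist_le_of_gridCell hε hk0 hk hm h⟩
  refine ⟨fun h hh1 hh2 => ?_, fun h hh1 hh2 => ?_⟩
  · exact GeometricMEG.isExpander_small (cell := fun i => GeometricMEG.gridCell hm (X i)) hR
      (fun u v huv hc => hadj u v huv (Or.inl hc)) hlo hh1 hh2
  · exact GeometricMEG.isExpander_large (cell := fun i => GeometricMEG.gridCell hm (X i)) hR
      (by simpa using hRn) hadj hlo hhi hh1 (by simpa using hh2)
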